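/- Let $\mathcal F$ be a weakly simple polygon, possibly with holes, whose vertices are in general position (no three collinear); that is, the interior of $\mathcal F$ is a bounded face (a bounded connected component of the complement) of a plane straight-line graph $G$ with finitely many vertices, no three of them collinear. Here $G$ may be disconnected and may have isolated vertices, so that the boundary of $\mathcal F$ may touch itself, an edge may have $\mathcal F$ on both sides, and a hole may degenerate to a tree or a point. A chord of $\mathcal F$ is a segment joining two distinct vertices of $\mathcal F$ whose relative interior lies in the interior of $\mathcal F$. A set of chords forms a triangulation of $\mathcal F$ if no two of its chords cross (their relative interiors are pairwise disjoint) and the chords cut the interior of $\mathcal F$ into open triangles whose corners are vertices of $\mathcal F$. Let $R$ and $B$ be two disjoint sets of chords, each of which forms a triangulation of $\mathcal F$. Then the intersection graph of the open segments in $R\cup B$ (nodes are the chords, and two distinct chords are adjacent if their relative interiors meet) is connected, i.e. any two of its nodes are joined by a path (a condition that is void if there are no chords). Consequently, the only partition of $R\cup B$ into two sets of pairwise noncrossing chords is $\{R,B\}$: if $R\cup B=R'\cup B'$ with $R'\cap B'=\emptyset$ and neither $R'$ nor $B'$ contains two crossing chords, then $(R',B')=(R,B)$ or $(R',B')=(B,R)$.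 -/

import Mathlib

namespace Biplane

/-- The Euclidean plane. -/
abbrev Plane := EuclideanSpace ℝ (Fin 2)

/-- No three distinct points of `S` lie on a line. -/
def GeneralPosition (S : Set Plane) : Prop :=
  ∀ p ∈ S, ∀ q ∈ S, ∀ r ∈ S, p ≠ q → p ≠ r → q ≠ r → ¬ Collinear ℝ ({p, q, r} : Set Plane)

/-- The open line segment joining the two endpoints of an unordered pair of points. -/
def openEdge (e : Sym2 Plane) : Set Plane :=
  Sym2.lift ⟨fun a b => openSegment ℝ a b, fun a b => openSegment_symm ℝ a b⟩ e

/-- No two distinct segments of `E` cross, that is, their open segments are pairwise disjoint. -/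
def Noncrossing (E : Set (Sym2 Plane)) : Prop :=
  E.Pairwise fun e f => Disjoint (openEdge e) (openEdge f)

/-- The union of the open segments of `E`. -/
def drawing (E : Set (Sym2 Plane)) : Set Plane :=
  ⋃ e ∈ E, openEdge e

/-- A plane geometric graph: finitely many vertices in general position, and pairwise noncrossing
straight-line edges between distinct vertices. Isolated vertices are allowed, and the graph need
not be connected. -/
structure PlaneGraph where
  verts : Set Plane
  edges : Set (Sym2 Plane)
  finite_verts : verts.Finite
  generalPosition : GeneralPosition verts
  mem_verts : ∀ e ∈ edges, ∀ p ∈ e, p ∈ verts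
  not_isDiag : ∀ e ∈ edges, ¬ e.IsDiag
  noncrossing : Noncrossing edges

/-- The point set covered by the vertices and the edges of the graph. -/
def PlaneGraph.support (G : PlaneGraph) : Set Plane :=
  G.verts ∪ drawing G.edges

/-- `F` is (the interior of) a weakly simple polygon, possibly with holes, whose boundary is drawn
by `G`: a bounded face of `G`, that is, a bounded connected component of the complement of `G`.
The boundary of `F` may touch itself at vertices, may have `F` on both sides of an edge, and the
holes may degenerate to segments, trees or isolated points. -/
def PlaneGraph.IsWeaklySimplePolygon (G : PlaneGraph) (F : Set Plane) : Prop :=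
  (∃ x ∈ G.supportᶜ, F = connectedComponentIn G.supportᶜ x) ∧ Bornology.IsBounded F

/-- The vertices of the polygon `F`: the vertices of `G` on its boundary. -/
def PlaneGraph.polygonVerts (G : PlaneGraph) (F : Set Plane) : Set Plane :=
  {v ∈ G.verts | v ∈ frontier F}

/-- A chord of `F`: a segment that joins two distinct vertices of `F` through the interior. -/
def PlaneGraph.IsChord (G : PlaneGraph) (F : Set Plane) (e : Sym2 Plane) : Prop :=
  (∀ p ∈ e, p ∈ G.polygonVerts F) ∧ ¬ e.IsDiag ∧ openEdge e ⊆ F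

/-- The set `T` of chords forms a triangulation of `F`: the chords are pairwise noncrossing and
cut `F` into open triangles spanned by vertices of `F`. -/
structure PlaneGraph.IsTriangulation (G : PlaneGraph) (F : Set Plane) (T : Set (Sym2 Plane)) :
    Prop where
  isChord : ∀ e ∈ T, G.IsChord F e
  noncrossing : Noncrossing T
  triangle : ∀ x ∈ F \ drawing T,
    ∃ a ∈ G.polygonVerts F, ∃ b ∈ G.polygonVerts F, ∃ c ∈ G.polygonVerts F,
      connectedComponentIn (F \ drawing T) x = interior (convexHull ℝ ({a, b, c} : Set Plane))

/-- The intersection graph of the open segments of `E`: its nodes are the elements of `E`, two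
distinct ones being adjacent when their open segments meet. -/
def intersectionGraph (E : Set (Sym2 Plane)) : SimpleGraph E where
  Adj e f := e ≠ f ∧ (openEdge (e : Sym2 Plane) ∩ openEdge (f : Sym2 Plane)).Nonempty
  symm := ⟨fun _ _ h => ⟨h.1.symm, by rw [Set.inter_comm]; exact h.2⟩⟩
  loopless := ⟨fun _ h => h.1 rfl⟩

end Biplane

namespace Biplane

open Set AffineMap Topology

/-! ### Barycentric coordinates in a triangle -/

section Triangle

variable (T : AffineBasis (Fin 3) ℝ Plane) {i j k : Fin 3}

/-! A chord missing every chord of a triangulation would lie inside one open triangle with its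
endpoints at corners, which is impossible (`exists_crossing`). Hence every chord of R crosses B and
conversely, and it suffices to show that a class `C` closed under crossing that contains one chord
of R contains them all.

The local step is `mem_class_of_sides`. Let two sides of a triangle of R be chords, crossed by b and
b' of B. Each of b, b' enters the triangle there and cannot stop inside, since vertices lie outside
F. If one leaves through the other given side, the classes agree at once. If one ends at the corner
opposite the side it entered, it separates the triangle and meets the other. Otherwise both leave
through the third side, which is then itself a chord of R, crossed by both.

The global step, `subset_class`, passes from triangle to triangle by connectedness of F: the points
whose face or chord touches `C`, and those for which it does not, form two open sets covering F.

For uniqueness, a partition into noncrossing sets is a proper 2-colouring of the intersection graph,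
and a connected graph has at most one up to swapping colours. -/

theorem sum_coord (hij : i ≠ j) (hik : i ≠ k) (hjk : j ≠ k) (p : Plane) :
    T.coord i p + T.coord j p + T.coord k p = 1 := by
  have h := T.sum_coord_apply_eq_one p
  rw [Fin.sum_univ_three] at h
  fin_cases i <;> fin_cases j <;> fin_cases k <;> simp_all <;> linarith

theorem forall_of_distinct (hij : i ≠ j) (hik : i ≠ k) (hjk : j ≠ k) {P : Fin 3 → Prop}
    (hi : P i) (hj : P j) (hk : P k) (l : Fin 3) : P l := by
  have : l = i ∨ l = j ∨ l = k := by omega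
  rcases this with rfl | rfl | rfl <;> assumption

theorem ext_coord (hij : i ≠ j) (hik : i ≠ k) (hjk : j ≠ k) {p q : Plane}
    (hi : T.coord i p = T.coord i q) (hj : T.coord j p = T.coord j q) : p = q := by
  refine T.ext_elem (forall_of_distinct hij hik hjk hi hj ?_)
  have hp := sum_coord T hij hik hjk p
  have hq := sum_coord T hij hik hjk q
  linarith

theorem coord_lineMap (l : Fin 3) (p q : Plane) (t : ℝ) :
    T.coord l (lineMap p q t) = (1 - t) * T.coord l p + t * T.coord l q := by
  rw [AffineMap.apply_lineMap, lineMap_apply_ring]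

theorem exists_lineMap_of_mem_openSegment {p q m : Plane} (h : m ∈ openSegment ℝ p q) :
    ∃ t : ℝ, 0 < t ∧ t < 1 ∧ m = lineMap p q t := by
  rw [openSegment_eq_image_lineMap] at h
  obtain ⟨t, ht, rfl⟩ := h
  exact ⟨t, ht.1, ht.2, rfl⟩

theorem mem_openSegment_iff_coord (hij : i ≠ j) (hik : i ≠ k) (hjk : j ≠ k) {p : Plane} :
    p ∈ openSegment ℝ (T i) (T j) ↔ T.coord k p = 0 ∧ 0 < T.coord i p ∧ 0 < T.coord j p := by
  constructor
  · intro h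
    obtain ⟨t, h0, h1, rfl⟩ := exists_lineMap_of_mem_openSegment h
    simp only [coord_lineMap, T.coord_apply_eq, T.coord_apply_ne hij, T.coord_apply_ne hij.symm,
      T.coord_apply_ne hik.symm, T.coord_apply_ne hjk.symm]
    exact ⟨by ring, by linarith, by linarith⟩
  · rintro ⟨hk, hi, hj⟩
    have hs := sum_coord T hij hik hjk p
    have : p = lineMap (T i) (T j) (T.coord j p) := by
      refine ext_coord T hij hik hjk ?_ ?_ <;>
        simp only [coord_lineMap, T.coord_apply_eq, T.coord_apply_ne hij,
          T.coord_apply_ne hij.symm] <;> linarith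
    rw [this]
    exact lineMap_mem_openSegment ℝ _ _ ⟨hj, by linarith⟩

theorem eq_vertex_of_coord_eq_zero (hij : i ≠ j) (hik : i ≠ k) (hjk : j ≠ k) {p : Plane}
    (hi : T.coord i p = 0) (hj : T.coord j p = 0) : p = T k :=
  ext_coord T hij hik hjk (by rw [hi, T.coord_apply_ne hik]) (by rw [hj, T.coord_apply_ne hjk])

theorem collinear_of_coord_eq_zero (hij : i ≠ j) (hik : i ≠ k) (hjk : j ≠ k) {p : Plane}
    (hk : T.coord k p = 0) : Collinear ℝ ({p, T i, T j} : Set Plane) := by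
  have hs := sum_coord T hij hik hjk p
  have : p = lineMap (T i) (T j) (T.coord j p) := by
    refine ext_coord T hij hik hjk ?_ ?_ <;>
      simp only [coord_lineMap, T.coord_apply_eq, T.coord_apply_ne hij,
        T.coord_apply_ne hij.symm] <;> linarith
  refine collinear_insert_of_mem_affineSpan_pair ?_
  rw [this]
  exact lineMap_mem_affineSpan_pair _ _ _

theorem GeneralPosition.eq_or_eq_of_coord_eq_zero {V : Set Plane} (hV : GeneralPosition V)
    (hT : ∀ l, T l ∈ V) (hij : i ≠ j) (hik : i ≠ k) (hjk : j ≠ k) {z : Plane} (hz : z ∈ V)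
    (hk : T.coord k z = 0) : z = T i ∨ z = T j := by
  by_contra! h
  exact hV z hz _ (hT i) _ (hT j) h.1 h.2 (fun h => hij (T.ind.injective h))
    (collinear_of_coord_eq_zero T hij hik hjk hk)

/-- The line through a point `p` of the side `i j` and the opposite vertex `k` separates the
vertex `i` from the vertex `j`, so the segments that do so inside the triangle meet. -/
theorem inter_openSegment_of_separated (hij : i ≠ j) (hik : i ≠ k) (hjk : j ≠ k)
    {p q m : Plane} (hp : p ∈ openSegment ℝ (T i) (T j)) (hq : q ∈ openSegment ℝ (T i) (T k))
    (hi : T.coord i m = 0) (hj : 0 < T.coord j m) (hk : 0 ≤ T.coord k m) :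
    (openSegment ℝ p (T k) ∩ openSegment ℝ q m).Nonempty := by
  rw [mem_openSegment_iff_coord T hij hik hjk] at hp
  rw [mem_openSegment_iff_coord T hik hij hjk.symm] at hq
  obtain ⟨pk, pi, pj⟩ := hp
  obtain ⟨qj, qi, qk⟩ := hq
  have sp := sum_coord T hij hik hjk p
  set a := T.coord i p * T.coord j m with ha
  set b := T.coord j p * T.coord i q with hb
  have apos : 0 < a := mul_pos pi hj
  have bpos : 0 < b := mul_pos pj qi
  have hab : 0 < a + b := add_pos apos bpos
  set t := b / (a + b) with ht
  have t0 : 0 < t := div_pos bpos hab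
  have t1' : 1 - t = a / (a + b) := by rw [ht]; field_simp; ring
  have t1 : 0 < 1 - t := t1' ▸ div_pos apos hab
  have hcross : (1 - t) * b = t * a := by rw [t1', ht]; ring
  set n := lineMap (k := ℝ) q m t with hn
  have ni : T.coord i n = (1 - t) * T.coord i q := by rw [hn, coord_lineMap, hi]; ring
  have nj : T.coord j n = t * T.coord j m := by rw [hn, coord_lineMap, qj]; ring
  have nk : T.coord k n = (1 - t) * T.coord k q + t * T.coord k m := by rw [hn, coord_lineMap]
  have nk0 : 0 < T.coord k n := by rw [nk]; positivity
  have sn := sum_coord T hij hik hjk n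
  have key : T.coord j p * T.coord i n = T.coord i p * T.coord j n := by
    rw [ni, nj]; linear_combination hcross
  have ni0 : 0 < T.coord i n := by rw [ni]; positivity
  have nj0 : 0 < T.coord j n := by rw [nj]; positivity
  refine ⟨n, ?_, lineMap_mem_openSegment ℝ _ _ ⟨t0, by linarith⟩⟩
  have : n = lineMap p (T k) (T.coord k n) := by
    refine ext_coord T hij hik hjk ?_ ?_
    · rw [coord_lineMap T i p, T.coord_apply_ne hik]
      linear_combination key - T.coord i n * sp + T.coord i n * pk + T.coord i p * sn
    · rw [coord_lineMap T j p, T.coord_apply_ne hjk]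
      linear_combination -key - T.coord j n * sp + T.coord j n * pk + T.coord j p * sn
  rw [this]
  exact lineMap_mem_openSegment ℝ _ _ ⟨nk0, by linarith⟩

/-- A segment that enters the open triangle through the side `i j` and does not end inside leaves
it through one of the other two sides or at the opposite vertex. -/
theorem exists_exit (hij : i ≠ j) (hik : i ≠ k) (hjk : j ≠ k) {p z : Plane}
    (hp : p ∈ openSegment ℝ (T i) (T j)) (hz : 0 < T.coord k z)
    (hout : ¬ ∀ l, 0 < T.coord l z) :
    ∃ m, (m = z ∨ m ∈ openSegment ℝ p z) ∧ 0 < T.coord k m ∧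
      (T.coord i m = 0 ∧ 0 ≤ T.coord j m ∨ T.coord j m = 0 ∧ 0 ≤ T.coord i m) := by
  rw [mem_openSegment_iff_coord T hij hik hjk] at hp
  obtain ⟨pk, pi, pj⟩ := hp
  -- The exit point is where coordinate `i` vanishes. The cross-product inequality says that
  -- coordinate `j` has not become negative by then; comparing the two products decides which
  -- coordinate vanishes first.
  have main : ∀ {i j : Fin 3}, 0 < T.coord i p → 0 < T.coord j p → T.coord i z ≤ 0 →
      T.coord j z * T.coord i p ≥ T.coord i z * T.coord j p →
      ∃ m, (m = z ∨ m ∈ openSegment ℝ p z) ∧ 0 < T.coord k m ∧ T.coord i m = 0 ∧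
        0 ≤ T.coord j m := by
    intro i j pi pj zi hle
    set d := T.coord i p - T.coord i z with hd
    have d0 : 0 < d := by linarith
    set t := T.coord i p / d with ht
    have t0 : 0 < t := div_pos pi d0
    have htd : t * d = T.coord i p := div_mul_cancel₀ _ d0.ne'
    have t1 : t ≤ 1 := (div_le_one d0).2 (by linarith)
    refine ⟨lineMap p z t, ?_, ?_, ?_, ?_⟩
    · rcases t1.eq_or_lt with h | h
      · left; rw [h, lineMap_apply_one]
      · right; exact lineMap_mem_openSegment ℝ _ _ ⟨t0, h⟩
    · rw [coord_lineMap, pk]; simp only [mul_zero, zero_add]; positivity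
    · rw [coord_lineMap]; linear_combination -htd
    · rw [coord_lineMap]
      have h1 : 1 - t = -T.coord i z / d := by rw [ht]; field_simp; ring
      have : (1 - t) * T.coord j p + t * T.coord j z =
          (T.coord j z * T.coord i p - T.coord i z * T.coord j p) / d := by
        rw [h1, ht]; ring
      rw [this]
      exact div_nonneg (by linarith) d0.le
  have hor : T.coord i z ≤ 0 ∨ T.coord j z ≤ 0 := by
    by_contra! h
    exact hout (forall_of_distinct hij hik hjk h.1 h.2 hz)
  by_cases hc : T.coord j z * T.coord i p ≥ T.coord i z * T.coord j p
  · have zi : T.coord i z ≤ 0 := by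
      rcases hor with h | h
      · exact h
      · by_contra! h'
        nlinarith [mul_pos h' pj]
    obtain ⟨m, h1, h2, h3⟩ := main pi pj zi hc
    exact ⟨m, h1, h2, Or.inl h3⟩
  · have zj : T.coord j z ≤ 0 := by
      rcases hor with h | h
      · by_contra! h'
        nlinarith [mul_pos h' pi]
      · exact h
    obtain ⟨m, h1, h2, h3⟩ := main pj pi zj (by linarith)
    exact ⟨m, h1, h2, Or.inr h3⟩

/-- Close to `p` the coordinates `i` and `j` stay positive by continuity, while coordinate `k` grows
linearly from zero. -/
theorem exists_mem_interior_of_enters (hij : i ≠ j) (hik : i ≠ k) (hjk : j ≠ k) {p z : Plane}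
    (hp : p ∈ openSegment ℝ (T i) (T j)) (hz : 0 < T.coord k z) :
    ∃ m ∈ openSegment ℝ p z, ∀ l, 0 < T.coord l m := by
  rw [mem_openSegment_iff_coord T hij hik hjk] at hp
  obtain ⟨pk, pi, pj⟩ := hp
  have near : ∀ l, 0 < T.coord l p → ∀ᶠ t : ℝ in 𝓝[>] 0, 0 < T.coord l (lineMap p z t) := by
    intro l hl
    have hc : Continuous fun t : ℝ => T.coord l (lineMap p z t) := by
      simp only [coord_lineMap]; fun_prop
    refine (hc.tendsto 0).eventually (lt_mem_nhds ?_) |>.filter_mono nhdsWithin_le_nhds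
    simpa using hl
  obtain ⟨t, hi, hj, ht⟩ := ((near i pi).and ((near j pj).and
    (Ioo_mem_nhdsGT (zero_lt_one (α := ℝ))))).exists
  refine ⟨lineMap p z t, lineMap_mem_openSegment ℝ _ _ ht, forall_of_distinct hij hik hjk hi hj ?_⟩
  rw [coord_lineMap, pk]
  simpa using mul_pos ht.1 hz

theorem interior_convexHull_range : interior (convexHull ℝ (range T)) =
    {x | ∀ l, 0 < T.coord l x} :=
  T.interior_convexHull

end Triangle

/-- The definition of a triangulation does not ask the three corners to be distinct or noncollinear;
a nonempty face forces it. -/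
theorem exists_affineBasis_of_interior_nonempty {a b c : Plane}
    (h : (interior (convexHull ℝ ({a, b, c} : Set Plane))).Nonempty) :
    ∃ T : AffineBasis (Fin 3) ℝ Plane, range T = {a, b, c} := by
  rw [interior_convexHull_nonempty_iff_affineSpan_eq_top] at h
  have hr : range ![a, b, c] = {a, b, c} := by
    simp only [Matrix.range_cons, Matrix.range_empty, union_empty, singleton_union]
  have hind : AffineIndependent ℝ ![a, b, c] := by
    rw [affineIndependent_iff_not_collinear_set, collinear_iff_finrank_le_one,
      ← direction_affineSpan, h, AffineSubspace.direction_top, finrank_top]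
    simp
  exact ⟨⟨![a, b, c], hind, by rw [hr, h]⟩, hr⟩

/-! ### Polygons and sets of chords -/

theorem isClosed_union_drawing {V : Set Plane} (hV : V.Finite) {E : Set (Sym2 Plane)}
    (hE : ∀ e ∈ E, ∀ p ∈ e, p ∈ V) : IsClosed (V ∪ drawing E) := by
  have hEf : E.Finite := by
    refine ((hV.prod hV).image fun x => s(x.1, x.2)).subset ?_
    intro e
    induction e with | _ a b =>
    intro he
    exact ⟨(a, b), ⟨hE _ he a (Sym2.mem_mk_left a b), hE _ he b (Sym2.mem_mk_right a b)⟩, rfl⟩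
  have : V ∪ drawing E = V ∪ ⋃ e ∈ E, closure (openEdge e) := by
    refine Subset.antisymm (union_subset_union_right _
      (iUnion₂_mono fun e _ => subset_closure)) (union_subset subset_union_left ?_)
    refine iUnion₂_subset fun e he x hx => ?_
    induction e with | _ a b =>
    change x ∈ closure (openSegment ℝ a b) at hx
    rw [closure_openSegment, ← insert_endpoints_openSegment] at hx
    rcases hx with rfl | rfl | hx
    · exact Or.inl (hE _ he _ (Sym2.mem_mk_left _ _))
    · exact Or.inl (hE _ he _ (Sym2.mem_mk_right _ _))
    · exact Or.inr (mem_biUnion he hx)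
  rw [this]
  exact hV.isClosed.union (hEf.isClosed_biUnion fun e _ => isClosed_closure)

theorem openEdge_nonempty (e : Sym2 Plane) : (openEdge e).Nonempty := by
  induction e with | _ a b =>
  exact ⟨midpoint ℝ a b, midpoint_mem_openSegment a b⟩

theorem openEdge_isPreconnected (e : Sym2 Plane) : IsPreconnected (openEdge e) := by
  induction e with | _ a b =>
  exact (convex_openSegment a b).isPreconnected

namespace PlaneGraph

variable {G : PlaneGraph} {F : Set Plane} {E R B : Set (Sym2 Plane)}

theorem isClosed_support (G : PlaneGraph) : IsClosed G.support :=
  isClosed_union_drawing G.finite_verts G.mem_verts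

theorem IsWeaklySimplePolygon.isOpen (hF : G.IsWeaklySimplePolygon F) : IsOpen F := by
  obtain ⟨⟨x, -, rfl⟩, -⟩ := hF
  exact G.isClosed_support.isOpen_compl.connectedComponentIn

theorem IsWeaklySimplePolygon.isPreconnected (hF : G.IsWeaklySimplePolygon F) :
    IsPreconnected F := by
  obtain ⟨⟨x, -, rfl⟩, -⟩ := hF
  exact isPreconnected_connectedComponentIn

theorem IsWeaklySimplePolygon.notMem_of_mem_verts (hF : G.IsWeaklySimplePolygon F) {v : Plane}
    (hv : v ∈ G.verts) : v ∉ F := by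
  obtain ⟨⟨x, -, rfl⟩, -⟩ := hF
  exact fun h => connectedComponentIn_subset _ _ h (Or.inl hv)

theorem IsChord.mem_verts {e : Sym2 Plane} (he : G.IsChord F e) {p : Plane} (hp : p ∈ e) :
    p ∈ G.verts :=
  (he.1 p hp).1

/-- Open segments are not closed, but adding the vertices closes their union, and F contains no
vertex. -/
theorem IsWeaklySimplePolygon.isOpen_diff_drawing (hF : G.IsWeaklySimplePolygon F)
    (hE : ∀ e ∈ E, G.IsChord F e) : IsOpen (F \ drawing E) := by
  have : F \ drawing E = F \ (G.verts ∪ drawing E) := by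
    ext x
    simp only [mem_sdiff, mem_union, not_or]
    exact ⟨fun h => ⟨h.1, fun hv => hF.notMem_of_mem_verts hv h.1, h.2⟩, fun h => ⟨h.1, h.2.2⟩⟩
  rw [this]
  exact hF.isOpen.sdiff (isClosed_union_drawing G.finite_verts fun e he p hp =>
    (hE e he).mem_verts hp)


theorem openSegment_subset_openSegment_left {a b p : Plane} (hp : p ∈ openSegment ℝ a b) :
    openSegment ℝ p a ⊆ openSegment ℝ a b := by
  obtain ⟨u, v, hu, hv, huv, rfl⟩ := hp
  rintro _ ⟨c, d, hc, hd, hcd, rfl⟩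
  refine ⟨c * u + d, c * v, by positivity, by positivity, ?_, by module⟩
  linear_combination c * huv + hcd

theorem exists_ne_ne (k : Fin 3) : ∃ i j : Fin 3, i ≠ j ∧ i ≠ k ∧ j ≠ k := by
  decide +revert

/-! ### Chords meeting a triangle -/

section Triangle

variable (T : AffineBasis (Fin 3) ℝ Plane) {i j k : Fin 3}

theorem coord_nonneg_of_mem_closure {p : Plane} (hp : p ∈ closure {x | ∀ l, 0 < T.coord l x})
    (l : Fin 3) : 0 ≤ T.coord l p := by
  have hc : IsClosed {x | 0 ≤ T.coord l x} :=
    isClosed_le continuous_const (continuous_barycentric_coord T l)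
  exact closure_minimal (fun x hx => (hx l).le) hc hp

theorem mem_closure_of_mem_side (hij : i ≠ j) (hik : i ≠ k) (hjk : j ≠ k) {p : Plane}
    (hp : p ∈ openSegment ℝ (T i) (T j)) : p ∈ closure {x | ∀ l, 0 < T.coord l x} := by
  have hsub : openSegment ℝ (T k) p ⊆ {x | ∀ l, 0 < T.coord l x} := by
    intro m hm
    rw [mem_openSegment_iff_coord T hij hik hjk] at hp
    obtain ⟨pk, pi, pj⟩ := hp
    obtain ⟨t, h0, h1, rfl⟩ := exists_lineMap_of_mem_openSegment hm
    refine forall_of_distinct hij hik hjk ?_ ?_ ?_ <;> rw [coord_lineMap]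
    · rw [T.coord_apply_ne hik]; simpa using mul_pos h0 pi
    · rw [T.coord_apply_ne hjk]; simpa using mul_pos h0 pj
    · rw [T.coord_apply_eq, pk]; linarith
  exact closure_mono hsub (segment_subset_closure_openSegment (right_mem_segment ℝ _ _))

/-- A chord that meets a side of a triangle without being that side enters the triangle. -/
theorem IsChord.exists_endpoint_coord_pos (hT : ∀ l, T l ∈ G.verts) {e : Sym2 Plane}
    (he : G.IsChord F e) (hij : i ≠ j) (hik : i ≠ k) (hjk : j ≠ k) {p : Plane}
    (hpe : p ∈ openEdge e) (hp : p ∈ openSegment ℝ (T i) (T j)) (hne : e ≠ s(T i, T j)) :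
    ∃ z ∈ e, 0 < T.coord k z ∧ openSegment ℝ p z ⊆ openEdge e := by
  induction e with | _ a b =>
  change p ∈ openSegment ℝ a b at hpe
  have pk := ((mem_openSegment_iff_coord T hij hik hjk).1 hp).1
  have hab : a ≠ b := he.2.1
  obtain ⟨t, h0, h1, hpt⟩ := exists_lineMap_of_mem_openSegment hpe
  rw [hpt, coord_lineMap] at pk
  have hor : 0 < T.coord k a ∨ 0 < T.coord k b := by
    -- The coordinate vanishes at the interior point `p`, so it vanishes at both endpoints; general
    -- position then makes `e` the side itself.
    by_contra! h
    have ha : T.coord k a = 0 := by nlinarith [h.1, h.2]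
    have hb : T.coord k b = 0 := by nlinarith [h.1, h.2]
    have ha' := G.generalPosition.eq_or_eq_of_coord_eq_zero T hT hij hik hjk
      (he.mem_verts (Sym2.mem_mk_left a b)) ha
    have hb' := G.generalPosition.eq_or_eq_of_coord_eq_zero T hT hij hik hjk
      (he.mem_verts (Sym2.mem_mk_right a b)) hb
    rcases ha' with rfl | rfl <;> rcases hb' with rfl | rfl
    · exact hab rfl
    · exact hne rfl
    · exact hne Sym2.eq_swap
    · exact hab rfl
  rcases hor with h | h
  · exact ⟨a, Sym2.mem_mk_left a b, h, openSegment_subset_openSegment_left hpe⟩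
  · refine ⟨b, Sym2.mem_mk_right a b, h, ?_⟩
    change openSegment ℝ p b ⊆ openSegment ℝ a b
    rw [openSegment_symm] at hpe
    rw [openSegment_symm ℝ a b]
    exact openSegment_subset_openSegment_left hpe

theorem IsChord.eq_side (hT : ∀ l, T l ∈ G.verts) {e : Sym2 Plane} (he : G.IsChord F e)
    (hdisj : Disjoint (openEdge e) {x | ∀ l, 0 < T.coord l x})
    (hij : i ≠ j) (hik : i ≠ k) (hjk : j ≠ k) {p : Plane} (hpe : p ∈ openEdge e)
    (hp : p ∈ openSegment ℝ (T i) (T j)) : e = s(T i, T j) := by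
  by_contra hne
  obtain ⟨z, -, hz, hsub⟩ := he.exists_endpoint_coord_pos T hT hij hik hjk hpe hp hne
  obtain ⟨m, hm, hpos⟩ := exists_mem_interior_of_enters T hij hik hjk hp hz
  exact disjoint_left.1 hdisj (hsub hm) hpos

/-- The point `p` is neither interior to the triangle nor a corner, so it lies on an open side, and
`eq_side` applies. -/
theorem IsChord.exists_eq_side (hF : G.IsWeaklySimplePolygon F) (hT : ∀ l, T l ∈ G.verts)
    {e : Sym2 Plane} (he : G.IsChord F e)
    (hdisj : Disjoint (openEdge e) {x | ∀ l, 0 < T.coord l x}) {p : Plane} (hpe : p ∈ openEdge e)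
    (hp : ∀ l, 0 ≤ T.coord l p) :
    ∃ i j k : Fin 3, i ≠ j ∧ i ≠ k ∧ j ≠ k ∧ e = s(T i, T j) := by
  have hpv : ∀ l, p ≠ T l := fun l h => hF.notMem_of_mem_verts (hT l) (h ▸ he.2.2 hpe)
  obtain ⟨k, hk⟩ : ∃ k, T.coord k p = 0 := by
    by_contra! h
    exact disjoint_left.1 hdisj hpe fun l => (hp l).lt_of_ne' (h l)
  obtain ⟨i, j, hij, hik, hjk⟩ := exists_ne_ne k
  refine ⟨i, j, k, hij, hik, hjk, he.eq_side T hT hdisj hij hik hjk hpe ?_⟩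
  rw [mem_openSegment_iff_coord T hij hik hjk]
  refine ⟨hk, (hp i).lt_of_ne' fun h => hpv j ?_, (hp j).lt_of_ne' fun h => hpv i ?_⟩
  · exact eq_vertex_of_coord_eq_zero T hik hij hjk.symm h hk
  · exact eq_vertex_of_coord_eq_zero T hjk hij.symm hik.symm h hk

/-- A chord that crosses the side `i j` of a triangle inside the polygon crosses one of the other
two sides or ends at the vertex `k`. -/
theorem IsChord.exists_exit (hF : G.IsWeaklySimplePolygon F) (hT : ∀ l, T l ∈ G.verts)
    (hTF : {x | ∀ l, 0 < T.coord l x} ⊆ F) {e : Sym2 Plane} (he : G.IsChord F e)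
    (hij : i ≠ j) (hik : i ≠ k) (hjk : j ≠ k) {p : Plane} (hpe : p ∈ openEdge e)
    (hp : p ∈ openSegment ℝ (T i) (T j)) (hne : e ≠ s(T i, T j)) :
    (openEdge e ∩ openSegment ℝ (T i) (T k)).Nonempty ∨
      ∃ m, openSegment ℝ p m ⊆ openEdge e ∧ T.coord i m = 0 ∧ 0 ≤ T.coord j m ∧
        0 < T.coord k m ∧ (T.coord j m = 0 ∨ m ∈ openEdge e) := by
  obtain ⟨z, hze, hz, hsub⟩ := he.exists_endpoint_coord_pos T hT hij hik hjk hpe hp hne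
  have hzv : z ∈ G.verts := he.mem_verts hze
  have hout : ¬ ∀ l, 0 < T.coord l z := fun h => hF.notMem_of_mem_verts hzv (hTF h)
  obtain ⟨m, hm, hmk, hm'⟩ := Biplane.exists_exit T hij hik hjk hp hz hout
  rcases hm with rfl | hm
  · have hmT : m = T k := by
      rcases hm' with ⟨h, -⟩ | ⟨h, -⟩
      · refine (G.generalPosition.eq_or_eq_of_coord_eq_zero T hT hjk hij.symm hik.symm hzv
          h).resolve_left fun hm => ?_
        rw [hm, T.coord_apply_ne hjk.symm] at hmk
        exact hmk.false
      · refine (G.generalPosition.eq_or_eq_of_coord_eq_zero T hT hik hij hjk.symm hzv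
          h).resolve_left fun hm => ?_
        rw [hm, T.coord_apply_ne hik.symm] at hmk
        exact hmk.false
    have hj : T.coord j m = 0 := by rw [hmT, T.coord_apply_ne hjk]
    exact Or.inr ⟨m, hsub, by rw [hmT, T.coord_apply_ne hik], hj.ge, hmk, Or.inl hj⟩
  · have hsub' : openSegment ℝ p m ⊆ openEdge e := by
      refine Subset.trans ?_ hsub
      rw [openSegment_symm]
      exact openSegment_subset_openSegment_left hm
    rcases hm' with ⟨h, h'⟩ | ⟨h, h'⟩
    · exact Or.inr ⟨m, hsub', h, h', hmk, Or.inr (hsub hm)⟩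
    · refine Or.inl ⟨m, hsub hm, ?_⟩
      rw [mem_openSegment_iff_coord T hik hij hjk.symm]
      refine ⟨h, h'.lt_of_ne' fun h0 => ?_, hmk⟩
      have : m = T k := eq_vertex_of_coord_eq_zero T hij hik hjk h0 h
      exact hF.notMem_of_mem_verts (hT k) (this ▸ he.2.2 (hsub hm))

end Triangle

/-! ### Faces of a triangulation -/

theorem mem_drawing {x : Plane} : x ∈ drawing E ↔ ∃ e ∈ E, x ∈ openEdge e := by
  simp [drawing]

/-- Connected components are relatively closed. -/
theorem mem_connectedComponentIn_of_mem_closure {S : Set Plane} {x y : Plane}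
    (hy : y ∈ closure (connectedComponentIn S x)) (hyS : y ∈ S) :
    y ∈ connectedComponentIn S x := by
  have hx : x ∈ S := connectedComponentIn_nonempty_iff.1 (closure_nonempty_iff.1 ⟨y, hy⟩)
  have h : IsPreconnected (insert y (connectedComponentIn S x)) :=
    isPreconnected_connectedComponentIn.subset_closure (subset_insert _ _)
      (insert_subset hy subset_closure)
  exact h.subset_connectedComponentIn (mem_insert_of_mem _ (mem_connectedComponentIn hx))
    (insert_subset hyS (connectedComponentIn_subset _ _)) (mem_insert _ _)

theorem IsTriangulation.exists_affineBasis (hR : G.IsTriangulation F R) {x : Plane}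
    (hx : x ∈ F \ drawing R) :
    ∃ T : AffineBasis (Fin 3) ℝ Plane, (∀ l, T l ∈ G.verts) ∧
      connectedComponentIn (F \ drawing R) x = {y | ∀ l, 0 < T.coord l y} := by
  obtain ⟨a, ha, b, hb, c, hc, h⟩ := hR.triangle x hx
  obtain ⟨T, hT⟩ := exists_affineBasis_of_interior_nonempty
    (h ▸ connectedComponentIn_nonempty_iff.2 hx)
  refine ⟨T, fun l => ?_, by rw [h, ← hT, interior_convexHull_range]⟩
  have : T l ∈ ({a, b, c} : Set Plane) := hT ▸ mem_range_self l
  rcases this with h | h | h <;> rw [h]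
  exacts [ha.1, hb.1, hc.1]

/-- A chord that does not belong to a triangulation crosses one of its chords. -/
theorem IsTriangulation.exists_crossing (hF : G.IsWeaklySimplePolygon F)
    (hB : G.IsTriangulation F B) {e : Sym2 Plane} (he : G.IsChord F e) :
    ∃ b ∈ B, (openEdge e ∩ openEdge b).Nonempty := by
  by_contra! hcon
  have hsub : openEdge e ⊆ F \ drawing B := fun x hx => ⟨he.2.2 hx, fun hxB => by
    obtain ⟨b, hb, hxb⟩ := mem_drawing.1 hxB
    exact (hcon b hb).subset ⟨hx, hxb⟩⟩
  obtain ⟨x, hx⟩ := openEdge_nonempty e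
  obtain ⟨T, hT, hTx⟩ := hB.exists_affineBasis (hsub hx)
  have hcomp : openEdge e ⊆ {y | ∀ l, 0 < T.coord l y} :=
    hTx ▸ (openEdge_isPreconnected e).subset_connectedComponentIn hx hsub
  have hTF : {y | ∀ l, 0 < T.coord l y} ⊆ F :=
    hTx ▸ (connectedComponentIn_subset _ _).trans sdiff_subset
  -- An endpoint is a limit of points of the open triangle but lies outside F, so it is on the
  -- boundary, and by general position it is a corner.
  have hvert : ∀ z ∈ e, z ∈ closure (openEdge e) → ∃ l, z = T l := by
    intro z hze hz
    have hzv := he.mem_verts hze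
    have hnn := coord_nonneg_of_mem_closure T (closure_mono hcomp hz)
    obtain ⟨k, hk⟩ : ∃ k, T.coord k z = 0 := by
      by_contra! h
      exact hF.notMem_of_mem_verts hzv (hTF fun l => (hnn l).lt_of_ne' (h l))
    obtain ⟨i, j, hij, hik, hjk⟩ := exists_ne_ne k
    rcases G.generalPosition.eq_or_eq_of_coord_eq_zero T hT hij hik hjk hzv hk with h | h
    exacts [⟨i, h⟩, ⟨j, h⟩]
  induction e with | _ a b =>
  have hab : a ≠ b := he.2.1
  obtain ⟨i, rfl⟩ := hvert a (Sym2.mem_mk_left a b)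
    (segment_subset_closure_openSegment (left_mem_segment ℝ a b))
  obtain ⟨j, rfl⟩ := hvert b (Sym2.mem_mk_right _ b)
    (segment_subset_closure_openSegment (right_mem_segment ℝ _ b))
  have hij : i ≠ j := fun h => hab (by rw [h])
  obtain ⟨k, hik, hjk⟩ : ∃ k, i ≠ k ∧ j ≠ k := by clear * -; decide +revert
  have := ((mem_openSegment_iff_coord T hij hik hjk).1 hx).1
  exact (this ▸ hcomp hx k).false

/-! ### Crossing classes within one triangle -/

section Class

variable {C : Set (Sym2 Plane)}

/-- Two sides of a triangle of `R` lie in the same class of chords under crossing. -/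
theorem IsTriangulation.mem_class_of_sides (hF : G.IsWeaklySimplePolygon F)
    (hR : G.IsTriangulation F R) (hB : G.IsTriangulation F B) (hRB : Disjoint R B)
    (hC : ∀ e ∈ R ∪ B, ∀ f ∈ R ∪ B, (openEdge e ∩ openEdge f).Nonempty → e ∈ C → f ∈ C)
    {x : Plane} {T : AffineBasis (Fin 3) ℝ Plane} (hT : ∀ l, T l ∈ G.verts)
    (hTx : connectedComponentIn (F \ drawing R) x = {y | ∀ l, 0 < T.coord l y})
    {i j k : Fin 3} (hij : i ≠ j) (hik : i ≠ k) (hjk : j ≠ k)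
    (he : s(T i, T j) ∈ R) (hf : s(T i, T k) ∈ R) (heC : s(T i, T j) ∈ C) : s(T i, T k) ∈ C := by
  have hsub : {y | ∀ l, 0 < T.coord l y} ⊆ F \ drawing R :=
    hTx ▸ connectedComponentIn_subset _ _
  have hTF : {y | ∀ l, 0 < T.coord l y} ⊆ F := hsub.trans sdiff_subset
  obtain ⟨b, hb, p, hpe, hpb⟩ := hB.exists_crossing hF (hR.isChord _ he)
  obtain ⟨b', hb', q, hqf, hqb⟩ := hB.exists_crossing hF (hR.isChord _ hf)
  have hbC : b ∈ C := hC _ (Or.inl he) _ (Or.inr hb) ⟨p, hpe, hpb⟩ heC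
  suffices b' ∈ C from hC _ (Or.inr hb') _ (Or.inl hf) ⟨q, hqb, hqf⟩ this
  have key : (openEdge b ∩ openEdge b').Nonempty → b' ∈ C :=
    fun h => hC _ (Or.inr hb) _ (Or.inr hb') h hbC
  have hne : b ≠ s(T i, T j) := fun h => disjoint_left.1 hRB he (h ▸ hb)
  have hne' : b' ≠ s(T i, T k) := fun h => disjoint_left.1 hRB hf (h ▸ hb')
  rcases (hB.isChord b hb).exists_exit T hF hT hTF hij hik hjk hpb hpe hne with
    hmeet | ⟨m, hms, hmi, hmj, hmk, hm⟩
  · exact hC _ (Or.inl hf) _ (Or.inr hb') ⟨q, hqf, hqb⟩ (hC _ (Or.inr hb) _ (Or.inl hf) hmeet hbC)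
  rcases (hB.isChord b' hb').exists_exit T hF hT hTF hik hij hjk.symm hqb hqf hne' with
    hmeet | ⟨n, hns, hni, hnk, hnj, hn⟩
  · exact hC _ (Or.inl he) _ (Or.inr hb') (by rw [inter_comm]; exact hmeet) heC
  -- Here `b` ends at the corner `k`, and so separates the corner `i` from `j`.
  by_cases hmj0 : T.coord j m = 0
  · obtain rfl : m = T k := eq_vertex_of_coord_eq_zero T hij hik hjk hmi hmj0
    exact key ((inter_openSegment_of_separated T hij hik hjk hpe hqf hni hnj hnk).mono
      (inter_subset_inter hms hns))
  by_cases hnk0 : T.coord k n = 0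
  · obtain rfl : n = T j := eq_vertex_of_coord_eq_zero T hik hij hjk.symm hni hnk0
    refine key ?_
    rw [inter_comm]
    exact (inter_openSegment_of_separated T hik hij hjk.symm hqf hpe hmi hmk hmj).mono
      (inter_subset_inter hns hms)
  have hmb : m ∈ openEdge b := hm.resolve_left hmj0
  have hnb : n ∈ openEdge b' := hn.resolve_left hnk0
  have hms' : m ∈ openSegment ℝ (T j) (T k) :=
    (mem_openSegment_iff_coord T hjk hij.symm hik.symm).2 ⟨hmi, hmj.lt_of_ne' hmj0, hmk⟩
  have hns' : n ∈ openSegment ℝ (T j) (T k) :=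
    (mem_openSegment_iff_coord T hjk hij.symm hik.symm).2 ⟨hni, hnj, hnk.lt_of_ne' hnk0⟩
  -- A side of the triangle need not be a chord, but `m` is a point of F in the closure of the face
  -- and not in the face, so some chord of R passes through it.
  have hmR : m ∈ drawing R := by
    by_contra hmR
    have hmF : m ∈ F := (hB.isChord b hb).2.2 hmb
    have hcl := mem_closure_of_mem_side T hjk hij.symm hik.symm hms'
    rw [← hTx] at hcl
    have := mem_connectedComponentIn_of_mem_closure hcl ⟨hmF, hmR⟩
    rw [hTx] at this
    exact (hmi ▸ this i).false
  obtain ⟨r, hr, hmr⟩ := mem_drawing.1 hmR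
  have hdisj : Disjoint (openEdge r) {y | ∀ l, 0 < T.coord l y} :=
    disjoint_left.2 fun y hy hyT => (hsub hyT).2 (mem_drawing.2 ⟨r, hr, hy⟩)
  obtain rfl := (hR.isChord r hr).eq_side T hT hdisj hjk hij.symm hik.symm hmr hms'
  exact hC _ (Or.inl hr) _ (Or.inr hb') ⟨n, hns', hnb⟩
    (hC _ (Or.inr hb) _ (Or.inl hr) ⟨m, hmb, hmr⟩ hbC)

theorem IsTriangulation.mem_class_of_touch (hF : G.IsWeaklySimplePolygon F)
    (hR : G.IsTriangulation F R) (hB : G.IsTriangulation F B) (hRB : Disjoint R B)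
    (hC : ∀ e ∈ R ∪ B, ∀ f ∈ R ∪ B, (openEdge e ∩ openEdge f).Nonempty → e ∈ C → f ∈ C)
    {x : Plane} {e f : Sym2 Plane} (he : e ∈ R) (hf : f ∈ R)
    (hxe : (closure (connectedComponentIn (F \ drawing R) x) ∩ openEdge e).Nonempty)
    (hxf : (closure (connectedComponentIn (F \ drawing R) x) ∩ openEdge f).Nonempty)
    (heC : e ∈ C) : f ∈ C := by
  have hx : x ∈ F \ drawing R :=
    connectedComponentIn_nonempty_iff.1 (closure_nonempty_iff.1 hxe.left)
  obtain ⟨T, hT, hTx⟩ := hR.exists_affineBasis hx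
  have hside : ∀ r ∈ R, (closure (connectedComponentIn (F \ drawing R) x) ∩ openEdge r).Nonempty →
      ∃ i j k : Fin 3, i ≠ j ∧ i ≠ k ∧ j ≠ k ∧ r = s(T i, T j) := by
    rintro r hr ⟨p, hp, hpr⟩
    rw [hTx] at hp
    refine (hR.isChord r hr).exists_eq_side T hF hT (disjoint_left.2 fun y hy hyT => ?_) hpr
      (coord_nonneg_of_mem_closure T hp)
    rw [← hTx] at hyT
    exact (connectedComponentIn_subset _ _ hyT).2 (mem_drawing.2 ⟨r, hr, hy⟩)
  have main : ∀ {i j k : Fin 3}, i ≠ j → i ≠ k → j ≠ k → s(T i, T j) ∈ R → s(T i, T k) ∈ R →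
      s(T i, T j) ∈ C → s(T i, T k) ∈ C :=
    fun hij hik hjk => hR.mem_class_of_sides hF hB hRB hC hT hTx hij hik hjk
  obtain ⟨i, j, k, hij, hik, hjk, rfl⟩ := hside e he hxe
  obtain ⟨i', j', k', hij', hik', hjk', rfl⟩ := hside f hf hxf
  have hk : k' = k ∨ k' = j ∨ k' = i := by omega
  rcases hk with rfl | rfl | rfl
  · have : i' = i ∧ j' = j ∨ i' = j ∧ j' = i := by omega
    rcases this with ⟨rfl, rfl⟩ | ⟨rfl, rfl⟩
    · exact heC
    · rwa [Sym2.eq_swap]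
  · have : i' = i ∧ j' = k ∨ i' = k ∧ j' = i := by omega
    rcases this with ⟨rfl, rfl⟩ | ⟨rfl, rfl⟩
    · exact main hij hik hjk he hf heC
    · rw [Sym2.eq_swap] at hf ⊢
      exact main hij hik hjk he hf heC
  · rw [Sym2.eq_swap] at he heC
    have : i' = j ∧ j' = k ∨ i' = k ∧ j' = j := by omega
    rcases this with ⟨rfl, rfl⟩ | ⟨rfl, rfl⟩
    · exact main hij.symm hjk hik he hf heC
    · rw [Sym2.eq_swap] at hf ⊢
      exact main hij.symm hjk hik he hf heC

end Class

/-! ### Propagation through the polygon -/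

/-- Meeting the line of `a b` at both `x` and `m` forces `y` onto that line, so reaching `y` means
passing an endpoint. -/
theorem endpoint_mem_segment {a b x y m : Plane} (hx : x ∈ openSegment ℝ a b)
    (hy : y ∉ openSegment ℝ a b) (hm : m ∈ openSegment ℝ x y) (hm' : m ∈ openSegment ℝ a b) :
    a ∈ segment ℝ x y ∨ b ∈ segment ℝ x y := by
  obtain ⟨s, hs0, hs1, rfl⟩ := exists_lineMap_of_mem_openSegment hx
  obtain ⟨u, hu0, hu1, rfl⟩ := exists_lineMap_of_mem_openSegment hm'
  obtain ⟨t, ht0, ht1, ht⟩ := exists_lineMap_of_mem_openSegment hm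
  -- The parameter of `y` on the line through `a` and `b`.
  set w := s + (u - s) / t with hw
  have hyw : y = lineMap a b w := by
    have h1 : t • (y - lineMap a b s) = t • (lineMap a b w - lineMap a b s : Plane) := by
      have h2 : t * (w - s) = u - s := by rw [hw]; field_simp; ring
      have h3 : t • (y - lineMap a b s) = (lineMap a b u - lineMap a b s : Plane) := by
        rw [ht, lineMap_apply_module' (lineMap a b s) y t]; module
      have h4 : (lineMap a b u - lineMap a b s : Plane) = (u - s) • (b - a) := by
        rw [lineMap_apply_module', lineMap_apply_module']; module
      rw [h3, h4, ← h2, lineMap_apply_module', lineMap_apply_module']; module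
    exact sub_left_injective (smul_right_injective Plane ht0.ne' h1)
  have hor : w ≤ 0 ∨ 1 ≤ w := by
    by_contra! h
    exact hy (hyw ▸ lineMap_mem_openSegment ℝ a b h)
  have hmem : ∀ c r : ℝ, 0 ≤ r → r ≤ 1 → (1 - r) * s + r * w = c →
      lineMap a b c ∈ segment ℝ (lineMap a b s) y := by
    rintro _ r h0 h1 rfl
    rw [segment_eq_image_lineMap]
    refine ⟨r, ⟨h0, h1⟩, ?_⟩
    rw [hyw]
    simp only [lineMap_apply_module']
    module
  rcases hor with h | h
  · left
    have hd : 0 < s - w := by linarith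
    have := hmem 0 (s / (s - w)) (by positivity) ((div_le_one hd).2 (by linarith))
      (by field_simp; ring)
    rwa [lineMap_apply_zero] at this
  · right
    have hd : 0 < w - s := by linarith
    have := hmem 1 ((1 - s) / (w - s)) (div_nonneg (by linarith) hd.le)
      ((div_le_one hd).2 (by linarith)) (by field_simp; ring)
    rwa [lineMap_apply_one] at this

/-- Near a point of a chord, every face of the triangulation touches this chord. -/
theorem IsTriangulation.eventually_touch (hF : G.IsWeaklySimplePolygon F)
    (hR : G.IsTriangulation F R) {e : Sym2 Plane} (he : e ∈ R) {x : Plane} (hx : x ∈ openEdge e) :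
    ∀ᶠ y in 𝓝 x, y ∈ openEdge e ∨
      (closure (connectedComponentIn (F \ drawing R) y) ∩ openEdge e).Nonempty := by
  have hO : IsOpen (F \ drawing (R \ {e})) :=
    hF.isOpen_diff_drawing fun f hf => hR.isChord f hf.1
  have hxO : x ∈ F \ drawing (R \ {e}) := by
    refine ⟨(hR.isChord e he).2.2 hx, fun h => ?_⟩
    obtain ⟨f, hf, hxf⟩ := mem_drawing.1 h
    exact disjoint_left.1 (hR.noncrossing he hf.1 (Ne.symm hf.2)) hx hxf
  obtain ⟨ε, hε, hball⟩ := Metric.isOpen_iff.1 hO x hxO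
  filter_upwards [Metric.ball_mem_nhds x hε] with y hy
  refine or_iff_not_imp_left.2 fun hye => ⟨x, ?_, hx⟩
  have hseg : segment ℝ x y ⊆ F \ drawing (R \ {e}) :=
    ((convex_ball x ε).segment_subset (Metric.mem_ball_self hε) hy).trans hball
  -- Returning to `e` would take the segment over an endpoint of `e`, a vertex, although it stays in
  -- F.
  have hnot : ∀ m ∈ insert y (openSegment ℝ x y), m ∉ openEdge e := by
    rintro m (rfl | hm) hme
    · exact hye hme
    · have hch := hR.isChord e he
      induction e with | _ a b =>
      rcases endpoint_mem_segment hx hye hm hme with h | h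
      · exact hF.notMem_of_mem_verts (hch.mem_verts (Sym2.mem_mk_left a b)) (hseg h).1
      · exact hF.notMem_of_mem_verts (hch.mem_verts (Sym2.mem_mk_right a b)) (hseg h).1
  have hsub : insert y (openSegment ℝ x y) ⊆ F \ drawing R := by
    intro m hm
    have hmO := hseg ((insert_subset (right_mem_segment ℝ x y) (openSegment_subset_segment ℝ x y)) hm)
    refine ⟨hmO.1, fun h => ?_⟩
    obtain ⟨f, hf, hmf⟩ := mem_drawing.1 h
    by_cases hfe : f = e
    · exact hnot m hm (hfe ▸ hmf)
    · exact hmO.2 (mem_drawing.2 ⟨f, ⟨hf, hfe⟩, hmf⟩)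
  have hpre : IsPreconnected (insert y (openSegment ℝ x y)) :=
    (convex_openSegment x y).isPreconnected.subset_closure (subset_insert _ _)
      (insert_subset (segment_subset_closure_openSegment (right_mem_segment ℝ x y)) subset_closure)
  exact closure_mono ((subset_insert _ _).trans
    (hpre.subset_connectedComponentIn (mem_insert _ _) hsub))
    (segment_subset_closure_openSegment (left_mem_segment ℝ x y))

/-- A class of chords under crossing that contains a chord of `R` contains all of them. -/
theorem IsTriangulation.subset_class (hF : G.IsWeaklySimplePolygon F)
    (hR : G.IsTriangulation F R) (hB : G.IsTriangulation F B) (hRB : Disjoint R B)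
    {C : Set (Sym2 Plane)}
    (hC : ∀ e ∈ R ∪ B, ∀ f ∈ R ∪ B, (openEdge e ∩ openEdge f).Nonempty → e ∈ C → f ∈ C)
    (hne : (R ∩ C).Nonempty) : R ⊆ C := by
  -- At a point of a chord only that chord is related to it; elsewhere the chords touching its face
  -- are, so `N` is locally constant off the drawing.
  set N : Plane → Sym2 Plane → Prop := fun x e => x ∈ openEdge e ∨
    (closure (connectedComponentIn (F \ drawing R) x) ∩ openEdge e).Nonempty with hN
  have hdraw : ∀ {x e f}, e ∈ R → f ∈ R → x ∈ openEdge e → N x f → f = e := by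
    intro x e f he hf hxe hxf
    rcases hxf with hxf | hxf
    · by_contra hfe
      exact disjoint_left.1 (hR.noncrossing hf he hfe) hxf hxe
    · exact absurd (mem_drawing.2 ⟨e, he, hxe⟩)
        (connectedComponentIn_nonempty_iff.1 (closure_nonempty_iff.1 hxf.left)).2
  have hsame : ∀ {x e f}, e ∈ R → f ∈ R → N x e → N x f → e ∈ C → f ∈ C := by
    intro x e f he hf hxe hxf heC
    rcases hxe with hxe | hxe
    · rwa [hdraw he hf hxe hxf]
    rcases hxf with hxf | hxf
    · rwa [← hdraw hf he hxf (Or.inr hxe)]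
    · exact hR.mem_class_of_touch hF hB hRB hC he hf hxe hxf heC
  have hface : ∀ {x}, x ∈ F → x ∉ drawing R → ∀ᶠ y in 𝓝 x, ∀ e ∈ R, N y e ↔ N x e := by
    intro x hxF hx
    have hopen := (hF.isOpen_diff_drawing hR.isChord).connectedComponentIn (x := x)
    filter_upwards [hopen.mem_nhds (mem_connectedComponentIn ⟨hxF, hx⟩)] with y hy e he
    have hyR := (connectedComponentIn_subset _ _ hy).2
    have hxe : x ∉ openEdge e := fun h => hx (mem_drawing.2 ⟨e, he, h⟩)
    have hye : y ∉ openEdge e := fun h => hyR (mem_drawing.2 ⟨e, he, h⟩)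
    simp only [hN, hxe, hye, connectedComponentIn_eq hy]
  have hedge : ∀ {x e}, e ∈ R → x ∈ openEdge e → ∀ᶠ y in 𝓝 x, N y e :=
    fun he hx => hR.eventually_touch hF he hx
  have hU : IsOpen {x ∈ F | ∃ e ∈ R ∩ C, N x e} := by
    rw [isOpen_iff_mem_nhds]
    rintro x ⟨hxF, e, he, hxe⟩
    by_cases hx : x ∈ drawing R
    · obtain ⟨f, hf, hxf⟩ := mem_drawing.1 hx
      obtain rfl := hdraw hf he.1 hxf hxe
      filter_upwards [hF.isOpen.mem_nhds hxF, hedge hf hxf] with y hyF hy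
      exact ⟨hyF, e, he, hy⟩
    · filter_upwards [hF.isOpen.mem_nhds hxF, hface hxF hx] with y hyF hy
      exact ⟨hyF, e, he, (hy e he.1).2 hxe⟩
  have hW : IsOpen {x ∈ F | ∀ e ∈ R ∩ C, ¬ N x e} := by
    rw [isOpen_iff_mem_nhds]
    rintro x ⟨hxF, hxe⟩
    by_cases hx : x ∈ drawing R
    · obtain ⟨f, hf, hxf⟩ := mem_drawing.1 hx
      filter_upwards [hF.isOpen.mem_nhds hxF, hedge hf hxf] with y hyF hy
      -- Near `x` every point is also related to `f`, so a nearby chord of `C` would put `f` in `C`.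
      exact ⟨hyF, fun e he hye => hxe f ⟨hf, hsame he.1 hf hye hy he.2⟩ (Or.inl hxf)⟩
    · filter_upwards [hF.isOpen.mem_nhds hxF, hface hxF hx] with y hyF hy
      exact ⟨hyF, fun e he hye => hxe e he ((hy e he.1).1 hye)⟩
  have hsub : F ⊆ {x ∈ F | ∃ e ∈ R ∩ C, N x e} := by
    refine hF.isPreconnected.subset_left_of_subset_union hU hW
      (disjoint_left.2 fun x ⟨_, e, he, h⟩ ⟨_, h'⟩ => h' e he h) (fun x hx => ?_) ?_
    · by_cases h : ∃ e ∈ R ∩ C, N x e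
      · exact Or.inl ⟨hx, h⟩
      · push Not at h
        exact Or.inr ⟨hx, h⟩
    · obtain ⟨e, he⟩ := hne
      obtain ⟨x, hx⟩ := openEdge_nonempty e
      have hxF := (hR.isChord e he.1).2.2 hx
      exact ⟨x, hxF, hxF, e, he, Or.inl hx⟩
  intro f hf
  obtain ⟨x, hx⟩ := openEdge_nonempty f
  obtain ⟨-, e, he, hxe⟩ := hsub ((hR.isChord f hf).2.2 hx)
  exact hsame he.1 hf hxe (Or.inl hx) he.2

theorem preconnected_intersectionGraph (hF : G.IsWeaklySimplePolygon F)
    (hR : G.IsTriangulation F R) (hB : G.IsTriangulation F B) (hRB : Disjoint R B) :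
    (intersectionGraph (R ∪ B)).Preconnected := by
  intro e₀ f₀
  set C : Set (Sym2 Plane) := {f | ∃ hf : f ∈ R ∪ B,
    (intersectionGraph (R ∪ B)).Reachable e₀ ⟨f, hf⟩} with hCdef
  have hC : ∀ e ∈ R ∪ B, ∀ f ∈ R ∪ B, (openEdge e ∩ openEdge f).Nonempty → e ∈ C → f ∈ C := by
    rintro e he f hf hmeet ⟨_, hreach⟩
    by_cases hef : e = f
    · subst hef; exact ⟨hf, hreach⟩
    · refine ⟨hf, hreach.trans (SimpleGraph.Adj.reachable ⟨fun h => hef ?_, hmeet⟩)⟩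
      exact congrArg Subtype.val h
  have he₀ : e₀.1 ∈ C := ⟨e₀.2, .refl _⟩
  have hRne : (R ∩ C).Nonempty := by
    rcases e₀.2 with h | h
    · exact ⟨e₀, h, he₀⟩
    · obtain ⟨r, hr, hmeet⟩ := hR.exists_crossing hF (hB.isChord _ h)
      exact ⟨r, hr, hC _ e₀.2 _ (Or.inl hr) hmeet he₀⟩
  have hRC : R ⊆ C := hR.subset_class hF hB hRB hC hRne
  have hf₀ : f₀.1 ∈ C := by
    rcases f₀.2 with h | h
    · exact hRC h
    · obtain ⟨r, hr, hmeet⟩ := hR.exists_crossing hF (hB.isChord _ h)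
      exact hC _ (Or.inl hr) _ f₀.2 (by rwa [inter_comm]) (hRC hr)
  exact hf₀.2

end PlaneGraph

/-! ### Uniqueness of the partition -/

theorem Noncrossing.mem_iff_notMem {R B : Set (Sym2 Plane)} (hR : Noncrossing R)
    (hB : Noncrossing B) {e f : Sym2 Plane} (he : e ∈ R ∪ B)
    (hf : f ∈ R ∪ B) (hef : e ≠ f) (hmeet : (openEdge e ∩ openEdge f).Nonempty) :
    e ∈ R ↔ f ∉ R := by
  have hnd : ¬ Disjoint (openEdge e) (openEdge f) := not_disjoint_iff_nonempty_inter.2 hmeet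
  constructor
  · exact fun h h' => hnd (hR h h' hef)
  · intro h
    by_contra h'
    exact hnd (hB (he.resolve_left h') (hf.resolve_left h) hef)

/-- A partition of the nodes of a connected intersection graph into two noncrossing sets is
unique. -/
theorem eq_or_eq_of_preconnected {R B R' B' : Set (Sym2 Plane)}
    (hconn : (intersectionGraph (R ∪ B)).Preconnected) (hR : Noncrossing R) (hB : Noncrossing B)
    (hRB : Disjoint R B) (hunion : R' ∪ B' = R ∪ B) (hRB' : Disjoint R' B')
    (hR' : Noncrossing R') (hB' : Noncrossing B') : (R' = R ∧ B' = B) ∨ (R' = B ∧ B' = R) := by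
  -- Both colourings flip along each crossing, so whether they agree is constant along paths.
  have hconst : ∀ e f : ↥(R ∪ B), (intersectionGraph (R ∪ B)).Reachable e f →
      ((e.1 ∈ R ↔ e.1 ∈ R') ↔ (f.1 ∈ R ↔ f.1 ∈ R')) := by
    intro e f h
    rw [SimpleGraph.reachable_iff_reflTransGen] at h
    induction h with
    | refl => rfl
    | @tail g f _ hadj ih =>
      have hne : g.1 ≠ f.1 := fun h => hadj.1 (Subtype.ext h)
      have h1 := hR.mem_iff_notMem hB g.2 f.2 hne hadj.2
      have h2 := hR'.mem_iff_notMem hB' (hunion.symm.subset g.2) (hunion.symm.subset f.2) hne hadj.2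
      tauto
  have hmem : ∀ e, e ∈ R' ∨ e ∈ B' ↔ e ∈ R ∨ e ∈ B := fun e => by
    simpa using Set.ext_iff.1 hunion e
  have hd : ∀ e, e ∈ R → e ∉ B := fun _ h => disjoint_left.1 hRB h
  have hd' : ∀ e, e ∈ R' → e ∉ B' := fun _ h => disjoint_left.1 hRB' h
  by_cases h : ∀ e ∈ R ∪ B, (e ∈ R ↔ e ∈ R')
  · left
    constructor <;> ext e <;> have h1 := hmem e <;> have h2 := hd e <;> have h3 := hd' e <;>
      have h4 := h e <;> simp only [mem_union] at h4 <;> tauto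
  · right
    push Not at h
    obtain ⟨e₀, he₀, h₀⟩ := h
    have h : ∀ e ∈ R ∪ B, ¬ (e ∈ R ↔ e ∈ R') := fun e he => by
      have := hconst ⟨e₀, he₀⟩ ⟨e, he⟩ (hconn _ _)
      dsimp only at this
      tauto
    constructor <;> ext e <;> have h1 := hmem e <;> have h2 := hd e <;> have h3 := hd' e <;>
      have h4 := h e <;> simp only [mem_union] at h4 <;> tauto

end Biplane

theorem mainTheorem9 (G : Biplane.PlaneGraph) (F : Set Biplane.Plane)
    (hF : G.IsWeaklySimplePolygon F) (R B : Set (Sym2 Biplane.Plane))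
    (hR : G.IsTriangulation F R) (hB : G.IsTriangulation F B) (hRB : Disjoint R B) :
    (Biplane.intersectionGraph (R ∪ B)).Preconnected ∧
      ∀ R' B' : Set (Sym2 Biplane.Plane), R' ∪ B' = R ∪ B → Disjoint R' B' →
        Biplane.Noncrossing R' → Biplane.Noncrossing B' →
        (R' = R ∧ B' = B) ∨ (R' = B ∧ B' = R) := by
  have hconn := Biplane.PlaneGraph.preconnected_intersectionGraph hF hR hB hRB
  exact ⟨hconn, fun _ _ hunion hdisj hR' hB' =>
    Biplane.eq_or_eq_of_preconnected hconn hR.noncrossing hB.noncrossing hRB hunion hdisj hR' hB'⟩
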